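/- Let $\mathcal{H}$ be a separable complex Hilbert space. Let $\mathfrak{T}^+$ be the cone of positive trace-class operators on $\mathcal{H}$, and set $\mathfrak{S}=\{\rho\in\mathfrak{T}^+:\operatorname{Tr}\rho=1\}$ (states) and $\mathfrak{T}^1=\{\rho\in\mathfrak{T}^+:\operatorname{Tr}\rho\le 1\}$. For a (possibly unbounded) positive self-adjoint operator $H$ on $\mathcal{H}$ with spectral measure $E_H$ on the Borel sets of $[0,\infty)$, put $P_n=E_H([0,n])$ and, for $A\in\mathfrak{T}^+$, $$\operatorname{Tr}HA=\lim_{n\to\infty}\operatorname{Tr}(HP_nA)\in[0,+\infty].$$ **Theorem.** Let $H_1,H_2$ be arbitrary (possibly unbounded) positive self-adjoint operators on $\mathcal{H}$, let $E_1,E_2\in\mathbb{R}$, and let $s\subseteq\{1,2\}$. Then every extreme point of the set $$\{\rho\in\mathfrak{S}:\ \operatorname{Tr}H_k\rho\le E_k\ \text{for}\ k\in\{1,2\}\setminus s,\ \ \operatorname{Tr}H_k\rho=E_k\ \text{for}\ k\in s\}$$ is a pure state, that is, an orthogonal projection of rank one, and every extreme point of the set $$\{\rho\in\mathfrak{T}^1:\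 \operatorname{Tr}H_k\rho\le E_k\ \text{for}\ k\in\{1,2\}\setminus s,\ \ \operatorname{Tr}H_k\rho=E_k\ \text{for}\ k\in s\}$$ has rank at most one. -/

import Mathlib

open scoped InnerProductSpace NNReal ENNReal

namespace QState

/-- A spectral measure (projection-valued measure) on the Borel σ-algebra of `[0,∞)`: the values on
Borel sets are orthogonal projections, `E([0,∞)) = 1`, and `E` is countably additive in the strong
operator topology. -/
structure SpectralMeasure (ℋ : Type*) [NormedAddCommGroup ℋ] [InnerProductSpace ℂ ℋ]
    [CompleteSpace ℋ] where
  proj : Set ℝ≥0 → ℋ →L[ℂ] ℋ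
  isStarProjection : ∀ B, MeasurableSet B → IsStarProjection (proj B)
  proj_univ : proj Set.univ = 1
  hasSum_proj : ∀ f : ℕ → Set ℝ≥0, (∀ n, MeasurableSet (f n)) →
    Pairwise (fun m n => Disjoint (f m) (f n)) →
    ∀ x : ℋ, HasSum (fun n => proj (f n) x) (proj (⋃ n, f n) x)

namespace SpectralMeasure

theorem inner_proj {ℋ : Type*} [NormedAddCommGroup ℋ] [InnerProductSpace ℂ ℋ]
    [CompleteSpace ℋ] (E : SpectralMeasure ℋ) {B : Set ℝ≥0} (hB : MeasurableSet B) (x : ℋ) :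
    RCLike.re ⟪x, E.proj B x⟫_ℂ = ‖E.proj B x‖ ^ 2 := by
  have h := E.isStarProjection B hB
  have h1 : E.proj B (E.proj B x) = E.proj B x :=
    congrArg (fun T : ℋ →L[ℂ] ℋ => T x) h.isIdempotentElem.eq
  have h2 : ⟪E.proj B x, E.proj B x⟫_ℂ = ⟪x, E.proj B x⟫_ℂ := by
    have := ContinuousLinearMap.adjoint_inner_right (E.proj B) x (E.proj B x)
    rw [← ContinuousLinearMap.star_eq_adjoint, h.isSelfAdjoint.star_eq, h1] at this
    exact this.symm
  rw [← h2, inner_self_eq_norm_sq]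

theorem proj_empty {ℋ : Type*} [NormedAddCommGroup ℋ] [InnerProductSpace ℂ ℋ]
    [CompleteSpace ℋ] (E : SpectralMeasure ℋ) (x : ℋ) : E.proj ∅ x = 0 := by
  have h := E.hasSum_proj (fun _ => ∅) (fun _ => MeasurableSet.empty) (fun _ _ _ => by simp) x
  exact (summable_const_iff _).1 h.summable

/-- The scalar measure `B ↦ ⟨x, E(B) x⟩` on `[0,∞)`. -/
noncomputable def scalarMeasure {ℋ : Type*} [NormedAddCommGroup ℋ] [InnerProductSpace ℂ ℋ]
    [CompleteSpace ℋ] (E : SpectralMeasure ℋ) (x : ℋ) : MeasureTheory.Measure ℝ≥0 :=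
  MeasureTheory.Measure.ofMeasurable
    (fun B _ => ENNReal.ofReal (RCLike.re ⟪x, E.proj B x⟫_ℂ))
    (by simp [E.proj_empty x])
    (by
      intro f hf hd
      have h := E.hasSum_proj f hf hd x
      have h1 : HasSum (fun n => RCLike.re ⟪x, E.proj (f n) x⟫_ℂ)
          (RCLike.re ⟪x, E.proj (⋃ n, f n) x⟫_ℂ) := by
        have h2 := (h.mapL (innerSL ℂ x)).mapL RCLike.reCLM
        simpa using h2
      rw [← h1.tsum_eq, ENNReal.ofReal_tsum_of_nonneg _ h1.summable]
      intro n
      rw [E.inner_proj (hf n)]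
      positivity)

theorem scalarMeasure_apply {ℋ : Type*} [NormedAddCommGroup ℋ] [InnerProductSpace ℂ ℋ]
    [CompleteSpace ℋ] (E : SpectralMeasure ℋ) (x : ℋ) {B : Set ℝ≥0} (hB : MeasurableSet B) :
    E.scalarMeasure x B = ENNReal.ofReal (RCLike.re ⟪x, E.proj B x⟫_ℂ) :=
  MeasureTheory.Measure.ofMeasurable_apply B hB

/-- `E` is the spectral measure of `H`, that is, `H = ∫ t dE(t)`: the domain of `H` consists of the
vectors `x` with `∫ t² d⟨x, E(t) x⟩ < ∞`, and `⟨x, H x⟩ = ∫ t d⟨x, E(t) x⟩` on the domain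
(which determines `H`, by polarization). -/
def IsSpectralMeasureOf {ℋ : Type*} [NormedAddCommGroup ℋ] [InnerProductSpace ℂ ℋ]
    [CompleteSpace ℋ] (E : SpectralMeasure ℋ) (H : ℋ →ₗ.[ℂ] ℋ) : Prop :=
  (∀ x : ℋ, x ∈ H.domain ↔ ∫⁻ t : ℝ≥0, (t : ℝ≥0∞) ^ 2 ∂(E.scalarMeasure x) < ∞) ∧
  ∀ x : H.domain, ⟪(x : ℋ), H x⟫_ℂ = ((∫ t : ℝ≥0, (t : ℝ) ∂(E.scalarMeasure (x : ℋ)) : ℝ) : ℂ)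

theorem proj_compl_proj {ℋ : Type*} [NormedAddCommGroup ℋ] [InnerProductSpace ℂ ℋ]
    [CompleteSpace ℋ] (E : SpectralMeasure ℋ) {B : Set ℝ≥0} (hB : MeasurableSet B) (x : ℋ) :
    E.proj Bᶜ (E.proj B x) = 0 := by
  have key : E.proj B + E.proj Bᶜ = 1 := by
    ext y
    let f : ℕ → Set ℝ≥0 := fun n => if n = 0 then B else if n = 1 then Bᶜ else ∅
    have hf : ∀ n, MeasurableSet (f n) := by
      intro n
      by_cases h0 : n = 0
      · simpa [f, h0] using hB
      · by_cases h1 : n = 1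
        · simpa [f, h1] using hB
        · simp [f, h0, h1]
    have hd : Pairwise (fun m n => Disjoint (f m) (f n)) := by
      intro m n hmn
      by_cases h0 : m = 0 <;> by_cases h1 : m = 1 <;> by_cases h2 : n = 0 <;>
        by_cases h3 : n = 1 <;> simp_all [f, disjoint_compl_right, disjoint_compl_left]
    have hU : (⋃ n, f n) = Set.univ := by
      refine Set.eq_univ_of_forall fun t => Set.mem_iUnion.2 ?_
      by_cases ht : t ∈ B
      · exact ⟨0, by simpa [f] using ht⟩
      · exact ⟨1, by simpa [f] using ht⟩
    have h := E.hasSum_proj f hf hd y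
    rw [hU, E.proj_univ] at h
    have h' : HasSum (fun n => E.proj (f n) y) (∑ n ∈ Finset.range 2, E.proj (f n) y) := by
      apply hasSum_sum_of_ne_finset_zero
      intro n hn
      have : ¬ n = 0 ∧ ¬ n = 1 := by
        simp only [Finset.mem_range] at hn
        omega
      simp [f, this.1, this.2, E.proj_empty y]
    have := h'.unique h
    simpa [Finset.sum_range_succ, f] using this
  have h1 : E.proj B (E.proj B x) = E.proj B x :=
    congrArg (fun T : ℋ →L[ℂ] ℋ => T x) (E.isStarProjection B hB).isIdempotentElem.eq
  have h2 := congrArg (fun T : ℋ →L[ℂ] ℋ => T (E.proj B x)) key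
  simpa [h1] using h2

end SpectralMeasure

/-- A (possibly unbounded) positive operator: self-adjoint (in particular densely defined) with
nonnegative quadratic form. -/
def IsPositiveOperator {ℋ : Type*} [NormedAddCommGroup ℋ] [InnerProductSpace ℂ ℋ]
    [CompleteSpace ℋ] (H : ℋ →ₗ.[ℂ] ℋ) : Prop :=
  IsSelfAdjoint H ∧ ∀ x : H.domain, 0 ≤ RCLike.re ⟪(x : ℋ), H x⟫_ℂ

open Classical in
/-- The spectral projection `P_n = E_H([0,n])` of `H`. By the spectral theorem every positive
operator has a unique spectral measure, so the first case applies; the value `0` is only a default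
for operators `H` that are not positive. -/
noncomputable def spectralProj {ℋ : Type*} [NormedAddCommGroup ℋ] [InnerProductSpace ℂ ℋ]
    [CompleteSpace ℋ] (H : ℋ →ₗ.[ℂ] ℋ) (n : ℕ) : ℋ →L[ℂ] ℋ :=
  if h : ∃ E : SpectralMeasure ℋ, E.IsSpectralMeasureOf H
  then h.choose.proj (Set.Iic (n : ℝ≥0)) else 0

theorem spectralProj_mem_domain {ℋ : Type*} [NormedAddCommGroup ℋ] [InnerProductSpace ℂ ℋ]
    [CompleteSpace ℋ] (H : ℋ →ₗ.[ℂ] ℋ) (n : ℕ) (x : ℋ) : spectralProj H n x ∈ H.domain := by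
  unfold spectralProj
  split_ifs with h
  · have hE := h.choose_spec
    set E := h.choose
    rw [hE.1]
    set y := E.proj (Set.Iic (n : ℝ≥0)) x with hy
    have h0 : E.scalarMeasure y ((Set.Iic (n : ℝ≥0))ᶜ : Set ℝ≥0) = 0 := by
      rw [E.scalarMeasure_apply y measurableSet_Iic.compl, hy,
        E.proj_compl_proj measurableSet_Iic]
      simp
    have h1 : ∀ᵐ t : ℝ≥0 ∂(E.scalarMeasure y), (t : ℝ≥0∞) ^ 2 ≤ (n : ℝ≥0∞) ^ 2 := by
      rw [MeasureTheory.ae_iff]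
      refine MeasureTheory.measure_mono_null ?_ h0
      intro t ht hmem
      apply ht
      have h2 : (t : ℝ≥0∞) ≤ (n : ℝ≥0∞) := by exact_mod_cast hmem
      gcongr
    refine (MeasureTheory.lintegral_mono_ae h1).trans_lt ?_
    rw [MeasureTheory.lintegral_const, E.scalarMeasure_apply y MeasurableSet.univ]
    exact ENNReal.mul_lt_top (by simp) ENNReal.ofReal_lt_top
  · simp

/-- The everywhere defined operator `H P_n`. -/
noncomputable def truncation {ℋ : Type*} [NormedAddCommGroup ℋ] [InnerProductSpace ℂ ℋ]
    [CompleteSpace ℋ] (H : ℋ →ₗ.[ℂ] ℋ) (n : ℕ) : ℋ →ₗ[ℂ] ℋ :=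
  H.toFun ∘ₗ LinearMap.codRestrict H.domain (spectralProj H n : ℋ →ₗ[ℂ] ℋ)
    (spectralProj_mem_domain H n)

/-- The index set of a fixed orthonormal basis of `ℋ`. -/
noncomputable def basisIndex (ℋ : Type*) [NormedAddCommGroup ℋ] [InnerProductSpace ℂ ℋ]
    [CompleteSpace ℋ] : Set ℋ :=
  (exists_hilbertBasis ℂ ℋ).choose

/-- A fixed orthonormal basis of `ℋ`. -/
noncomputable def basis (ℋ : Type*) [NormedAddCommGroup ℋ] [InnerProductSpace ℂ ℋ]
    [CompleteSpace ℋ] : HilbertBasis (basisIndex ℋ) ℂ ℋ :=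
  (exists_hilbertBasis ℂ ℋ).choose_spec.choose

/-- `A` is trace-class: `∑ ⟨e_i, |A| e_i⟩ < ∞`, where `|A| = √(A* A)`. Whether this holds does
not depend on the orthonormal basis. -/
def IsTraceClass {ℋ : Type*} [NormedAddCommGroup ℋ] [InnerProductSpace ℂ ℋ]
    [CompleteSpace ℋ] (A : ℋ →L[ℂ] ℋ) : Prop :=
  Summable fun i => ⟪basis ℋ i, CFC.abs A (basis ℋ i)⟫_ℂ

/-- The trace `∑ ⟨e_i, A e_i⟩`. For trace-class operators the series converges absolutely, and its
value does not depend on the orthonormal basis. -/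
noncomputable def trace {ℋ : Type*} [NormedAddCommGroup ℋ] [InnerProductSpace ℂ ℋ]
    [CompleteSpace ℋ] (A : ℋ →ₗ[ℂ] ℋ) : ℂ :=
  ∑' i, ⟪basis ℋ i, A (basis ℋ i)⟫_ℂ

/-- The cone of positive trace-class operators. -/
def positiveTraceClass (ℋ : Type*) [NormedAddCommGroup ℋ] [InnerProductSpace ℂ ℋ]
    [CompleteSpace ℋ] : Set (ℋ →L[ℂ] ℋ) :=
  {A | A.IsPositive ∧ IsTraceClass A}

/-- The set of positive trace-class operators with trace at most one. -/
def subnormalizedStates (ℋ : Type*) [NormedAddCommGroup ℋ] [InnerProductSpace ℂ ℋ]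
    [CompleteSpace ℋ] : Set (ℋ →L[ℂ] ℋ) :=
  {A | A ∈ positiveTraceClass ℋ ∧ (trace (A : ℋ →ₗ[ℂ] ℋ)).re ≤ 1}

/-- The set of quantum states: positive trace-class operators with trace one. -/
def states (ℋ : Type*) [NormedAddCommGroup ℋ] [InnerProductSpace ℂ ℋ]
    [CompleteSpace ℋ] : Set (ℋ →L[ℂ] ℋ) :=
  {A | A ∈ positiveTraceClass ℋ ∧ trace (A : ℋ →ₗ[ℂ] ℋ) = 1}

/-- `Tr HA = lim_n Tr(H P_n A) ∈ [0,∞]`, for a positive operator `H` and a positive trace-class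
operator `A`. -/
noncomputable def expectedValue {ℋ : Type*} [NormedAddCommGroup ℋ] [InnerProductSpace ℂ ℋ]
    [CompleteSpace ℋ] (H : ℋ →ₗ.[ℂ] ℋ) (A : ℋ →L[ℂ] ℋ) : EReal :=
  Filter.limUnder Filter.atTop
    (fun n : ℕ => ((trace (truncation H n ∘ₗ (A : ℋ →ₗ[ℂ] ℋ))).re : EReal))

/-- The elements `ρ` of `K` with `Tr H_k ρ ≤ E_k` for `k ∉ s` and `Tr H_k ρ = E_k` for
`k ∈ s`. -/
def constrained {ℋ : Type*} [NormedAddCommGroup ℋ] [InnerProductSpace ℂ ℋ]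
    [CompleteSpace ℋ] (K : Set (ℋ →L[ℂ] ℋ)) {l : ℕ} (H : Fin l → (ℋ →ₗ.[ℂ] ℋ))
    (E : Fin l → ℝ) (s : Set (Fin l)) : Set (ℋ →L[ℂ] ℋ) :=
  {ρ | ρ ∈ K ∧ (∀ k, k ∉ s → expectedValue (H k) ρ ≤ (E k : EReal)) ∧
    ∀ k, k ∈ s → expectedValue (H k) ρ = (E k : EReal)}

/-- Pure states: orthogonal projections of rank one. -/
def IsPureState {ℋ : Type*} [NormedAddCommGroup ℋ] [InnerProductSpace ℂ ℋ]
    [CompleteSpace ℋ] (ρ : ℋ →L[ℂ] ℋ) : Prop :=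
  IsStarProjection ρ ∧ (ρ : ℋ →ₗ[ℂ] ℋ).rank = 1

end QState

/-! Suppose an admissible `A` has rank at least two, and choose `a`, `b` with `A a`, `A b` linearly
independent. The Hermitian operators on their span form a real space of dimension four, while the
trace and two energies impose only three real linear conditions. Hence some nonzero Hermitian `D` on
this span has zero trace and zero energies. By Cauchy–Schwarz `|A a⟩⟨A a| ≤ ⟨a, A a⟩ A`, so after
scaling `A ± D` are positive, and `A` is their midpoint: it is not extreme (`exists_perturbation`).
In rank one, trace one forces a projection.

The analytic point is that the energies of `D` make sense for unbounded `H`. The same inequality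
bounds the form of `H P_n` at `A a` by a constant times `Tr H P_n A` (`inner_le_trace_comp`). The
forms increase with `n` (`exists_truncation_eq`), so they converge, and the energy is affine along
these perturbations (`exists_expectedValue_add_rankOneSum`). -/

namespace QState

open MeasureTheory

/-! ### Spectral subspaces and the quadratic form of `H`. -/

namespace SpectralMeasure

variable {ℋ : Type*} [NormedAddCommGroup ℋ] [InnerProductSpace ℂ ℋ] [CompleteSpace ℋ]
  (E : SpectralMeasure ℋ)

theorem proj_proj {B : Set ℝ≥0} (hB : MeasurableSet B) (x : ℋ) :
    E.proj B (E.proj B x) = E.proj B x :=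
  congrArg (fun T : ℋ →L[ℂ] ℋ => T x) (E.isStarProjection B hB).isIdempotentElem.eq

theorem proj_sub_proj {B : Set ℝ≥0} (hB : MeasurableSet B) (x : ℋ) :
    E.proj B (x - E.proj B x) = 0 := by
  rw [map_sub, E.proj_proj hB, sub_self]

theorem scalarMeasure_eq_norm (x : ℋ) {B : Set ℝ≥0} (hB : MeasurableSet B) :
    E.scalarMeasure x B = ENNReal.ofReal (‖E.proj B x‖ ^ 2) := by
  rw [E.scalarMeasure_apply x hB, E.inner_proj hB]

theorem scalarMeasure_eq_zero_iff (x : ℋ) {B : Set ℝ≥0} (hB : MeasurableSet B) :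
    E.scalarMeasure x B = 0 ↔ E.proj B x = 0 := by
  rw [E.scalarMeasure_eq_norm x hB, ENNReal.ofReal_eq_zero]
  constructor
  · intro h
    have : ‖E.proj B x‖ ^ 2 = 0 := le_antisymm h (by positivity)
    simpa using this
  · intro h
    simp [h]

instance isFiniteMeasure_scalarMeasure (x : ℋ) : IsFiniteMeasure (E.scalarMeasure x) :=
  ⟨by rw [E.scalarMeasure_eq_norm x MeasurableSet.univ]; exact ENNReal.ofReal_lt_top⟩

theorem proj_eq_zero_of_subset {B C : Set ℝ≥0} (hB : MeasurableSet B) (hC : MeasurableSet C)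
    (hBC : B ⊆ C) {x : ℋ} (hx : E.proj C x = 0) : E.proj B x = 0 :=
  (E.scalarMeasure_eq_zero_iff x hB).1
    (measure_mono_null hBC ((E.scalarMeasure_eq_zero_iff x hC).2 hx))

/-- If `E(Cᶜ) p = 0` and `E(C) (x - p) = 0`, then the scalar measure of `p` is the restriction
to `C` of that of `x`. -/
theorem scalarMeasure_eq_restrict {C : Set ℝ≥0} (hC : MeasurableSet C) {x p : ℋ}
    (hp : E.proj Cᶜ p = 0) (hxp : E.proj C (x - p) = 0) :
    E.scalarMeasure p = (E.scalarMeasure x).restrict C := by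
  ext B hB
  rw [Measure.restrict_apply hB, ← measure_inter_add_sdiff B hC, Set.sdiff_eq,
    (E.scalarMeasure_eq_zero_iff p (hB.inter hC.compl)).2
      (E.proj_eq_zero_of_subset (hB.inter hC.compl) hC.compl Set.inter_subset_right hp),
    add_zero, E.scalarMeasure_eq_norm _ (hB.inter hC), E.scalarMeasure_eq_norm _ (hB.inter hC)]
  have h := E.proj_eq_zero_of_subset (hB.inter hC) hC Set.inter_subset_right hxp
  rw [map_sub, sub_eq_zero] at h
  rw [h]

theorem scalarMeasure_proj {C : Set ℝ≥0} (hC : MeasurableSet C) (x : ℋ) :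
    E.scalarMeasure (E.proj C x) = (E.scalarMeasure x).restrict C :=
  E.scalarMeasure_eq_restrict hC (E.proj_compl_proj hC x) (E.proj_sub_proj hC x)

/-- The measures of `p` and `q` are the restrictions of that of `p + q` to `C` and to its
complement. -/
theorem scalarMeasure_add {C : Set ℝ≥0} (hC : MeasurableSet C) {p q : ℋ}
    (hp : E.proj Cᶜ p = 0) (hq : E.proj C q = 0) :
    E.scalarMeasure (p + q) = E.scalarMeasure p + E.scalarMeasure q := by
  rw [E.scalarMeasure_eq_restrict hC (x := p + q) hp (by simpa using hq),
    E.scalarMeasure_eq_restrict hC.compl (x := p + q) (p := q) (by simpa using hq)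
      (by simpa using hp), Measure.restrict_add_restrict_compl hC]

variable {E} {H : ℋ →ₗ.[ℂ] ℋ}

theorem IsSpectralMeasureOf.integrable (hE : E.IsSpectralMeasureOf H) {x : ℋ}
    (hx : x ∈ H.domain) : Integrable (fun t : ℝ≥0 => (t : ℝ)) (E.scalarMeasure x) := by
  have h := (hE.1 x).1 hx
  refine ⟨by fun_prop, ?_⟩
  refine lt_of_le_of_lt (lintegral_mono (g := fun t : ℝ≥0 => 1 + (t : ℝ≥0∞) ^ 2) ?_) ?_
  · intro t
    have h1 : t ≤ 1 + t ^ 2 := by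
      rw [← NNReal.coe_le_coe]
      push_cast
      nlinarith [sq_nonneg ((t : ℝ) - 1), sq_nonneg (t : ℝ)]
    have h2 : ‖(t : ℝ)‖ₑ = (t : ℝ≥0∞) := by simp
    simp only [h2]
    exact_mod_cast h1
  · rw [lintegral_add_left measurable_const, lintegral_const, one_mul]
    exact ENNReal.add_lt_top.2 ⟨measure_lt_top _ _, h⟩

theorem IsSpectralMeasureOf.inner_add (hE : E.IsSpectralMeasureOf H) {C : Set ℝ≥0}
    (hC : MeasurableSet C) {p q : H.domain} (hp : E.proj Cᶜ (p : ℋ) = 0)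
    (hq : E.proj C (q : ℋ) = 0) :
    ⟪(p : ℋ), H q⟫_ℂ + ⟪(q : ℋ), H p⟫_ℂ = 0 := by
  have h := hE.2 (p + q)
  rw [Submodule.coe_add, E.scalarMeasure_add hC hp hq,
    integral_add_measure (hE.integrable p.2) (hE.integrable q.2), Complex.ofReal_add,
    ← hE.2 p, ← hE.2 q, LinearPMap.map_add, inner_add_left, inner_add_right, inner_add_right] at h
  linear_combination h

/-- Additivity of the form only kills the sum of the two cross terms; replacing `q` by `i q` kills
their difference as well. -/
theorem IsSpectralMeasureOf.inner_eq_zero (hE : E.IsSpectralMeasureOf H) {C : Set ℝ≥0}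
    (hC : MeasurableSet C) {p q : H.domain} (hp : E.proj Cᶜ (p : ℋ) = 0)
    (hq : E.proj C (q : ℋ) = 0) : ⟪(q : ℋ), H p⟫_ℂ = 0 := by
  have h1 := hE.inner_add hC hp hq
  have h2 := hE.inner_add hC (p := p) (q := Complex.I • q) hp (by simp [hq])
  rw [Submodule.coe_smul, LinearPMap.map_smul, inner_smul_left, inner_smul_right,
    Complex.conj_I] at h2
  have h3 := Complex.I_mul_I
  linear_combination (1 / 2) * h1 + (Complex.I / 2) * h2
    + (⟪(q : ℋ), H p⟫_ℂ / 2 - ⟪(p : ℋ), H q⟫_ℂ / 2) * h3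

theorem IsSpectralMeasureOf.inner_apply_proj (hE : E.IsSpectralMeasureOf H)
    (hd : Dense (H.domain : Set ℋ)) {C : Set ℝ≥0} (hC : MeasurableSet C) {x : ℋ}
    (hC' : ∀ y, E.proj C y ∈ H.domain) :
    ⟪x, H ⟨E.proj C x, hC' x⟩⟫_ℂ
      = ((∫ t in C, (t : ℝ) ∂(E.scalarMeasure x) : ℝ) : ℂ) := by
  -- Here `x` need not lie in the domain, so orthogonality is proved for `y` in the domain and
  -- extended by density.
  have key : ∀ y : ℋ, ⟪y - E.proj C y, H ⟨E.proj C x, hC' x⟩⟫_ℂ = 0 := by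
    have hc : Continuous fun y : ℋ => ⟪y - E.proj C y, H ⟨E.proj C x, hC' x⟩⟫_ℂ := by fun_prop
    have := hc.ext_on hd (g := fun _ => (0 : ℂ)) continuous_const (fun y hy =>
      hE.inner_eq_zero hC (p := ⟨E.proj C x, hC' x⟩)
        (q := ⟨y - E.proj C y, H.domain.sub_mem hy (hC' y)⟩)
        (E.proj_compl_proj hC x) (E.proj_sub_proj hC y))
    exact congrFun this
  have h1 := hE.2 ⟨E.proj C x, hC' x⟩
  rw [E.scalarMeasure_proj hC] at h1
  rw [← h1, ← sub_eq_zero, ← inner_sub_left]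
  exact key x

end SpectralMeasure

/-- The truncations `H P_n` of a densely defined operator are bounded and positive, and they
increase with `n`. For operators with a spectral measure, `⟨x, H P_n x⟩ = ∫_{[0,n]} t d⟨x, E(t) x⟩`;
for the others `spectralProj` has the default value `0`. -/
theorem exists_truncation_eq {ℋ : Type*} [NormedAddCommGroup ℋ] [InnerProductSpace ℂ ℋ]
    [CompleteSpace ℋ] (H : ℋ →ₗ.[ℂ] ℋ) (hd : Dense (H.domain : Set ℋ)) :
    ∃ T : ℕ → ℋ →L[ℂ] ℋ, (∀ n, truncation H n = (T n : ℋ →ₗ[ℂ] ℋ)) ∧ (∀ n, (T n).IsPositive) ∧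
      ∀ x, Monotone fun n => RCLike.re ⟪x, T n x⟫_ℂ := by
  suffices h : ∃ f : ℕ → ℋ → ℝ, (∀ n x, ⟪x, truncation H n x⟫_ℂ = (f n x : ℂ)) ∧
      (∀ n x, 0 ≤ f n x) ∧ ∀ x, Monotone fun n => f n x by
    obtain ⟨f, hf, h0, hm⟩ := h
    have hpos : ∀ n, (truncation H n).IsPositive := by
      intro n
      rw [LinearMap.isPositive_iff_complex]
      intro x
      rw [← inner_conj_symm, hf]
      simp [h0]
    -- Boundedness is Hellinger–Toeplitz: a symmetric operator defined everywhere is continuous.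
    refine ⟨fun n => ⟨truncation H n, (hpos n).isSymmetric.continuous⟩, fun n => rfl,
      fun n => hpos n, fun x m n hmn => ?_⟩
    change (⟪x, truncation H m x⟫_ℂ).re ≤ (⟪x, truncation H n x⟫_ℂ).re
    rw [hf, hf]
    exact hm x hmn
  by_cases h : ∃ E : SpectralMeasure ℋ, E.IsSpectralMeasureOf H
  · have hE := h.choose_spec
    have hproj : ∀ n, spectralProj H n = h.choose.proj (Set.Iic (n : ℝ≥0)) := by
      intro n
      simp only [spectralProj, dif_pos h]
    set E := h.choose
    have hdom : ∀ (n : ℕ) y, E.proj (Set.Iic (n : ℝ≥0)) y ∈ H.domain := by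
      intro n y
      rw [← hproj]
      exact spectralProj_mem_domain H n y
    refine ⟨fun n x => ∫ t in Set.Iic (n : ℝ≥0), (t : ℝ) ∂(E.scalarMeasure x), fun n x => ?_,
      fun n x => integral_nonneg fun t => t.2, fun x m n hmn => ?_⟩
    · rw [← hE.inner_apply_proj hd measurableSet_Iic (hdom n)]
      have : LinearMap.codRestrict H.domain (spectralProj H n : ℋ →ₗ[ℂ] ℋ)
          (spectralProj_mem_domain H n) x = ⟨E.proj (Set.Iic (n : ℝ≥0)) x, hdom n x⟩ :=
        Subtype.ext (congrArg (fun T : ℋ →L[ℂ] ℋ => T x) (hproj n))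
      simp only [truncation, LinearMap.comp_apply, this]
      rfl
    · refine setIntegral_mono_set ?_ (Filter.Eventually.of_forall fun t => t.2)
        (Filter.Eventually.of_forall (Set.Iic_subset_Iic.2 (by exact_mod_cast hmn)))
      have := hE.integrable (hdom n x)
      rwa [E.scalarMeasure_proj measurableSet_Iic] at this
  · refine ⟨fun _ _ => 0, fun n x => ?_, fun _ _ => le_rfl, fun _ => monotone_const⟩
    have : LinearMap.codRestrict H.domain (spectralProj H n : ℋ →ₗ[ℂ] ℋ)
        (spectralProj_mem_domain H n) x = 0 := by
      apply Subtype.ext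
      simp [spectralProj, dif_neg h]
    simp only [truncation, LinearMap.comp_apply, this]
    simp

end QState

namespace QState

/-! ### Traces of products with a positive trace-class operator. -/

section Trace

variable {ℋ : Type*} [NormedAddCommGroup ℋ] [InnerProductSpace ℂ ℋ] {ι : Type*}

theorem hasSum_norm_inner_sq (b : HilbertBasis ι ℂ ℋ) (x : ℋ) :
    HasSum (fun i => ‖⟪b i, x⟫_ℂ‖ ^ 2) (‖x‖ ^ 2) := by
  have h := (b.hasSum_inner_mul_inner x x).mapL Complex.reCLM
  rw [inner_self_eq_norm_sq_to_K] at h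
  have h2 : Complex.reCLM ((‖x‖ : ℂ) ^ 2) = ‖x‖ ^ 2 := by
    rw [← Complex.ofReal_pow]; rfl
  convert h using 1
  · funext i
    change _ = RCLike.re (⟪x, b i⟫_ℂ * ⟪b i, x⟫_ℂ)
    rw [inner_mul_symm_re_eq_norm, norm_mul, norm_inner_symm, sq]
  · exact h2.symm

/-- A square-summable family of images of basis vectors has a square-summable matrix. -/
theorem summable_norm_inner_sq (b : HilbertBasis ι ℂ ℋ) {f : ι → ℋ}
    (hf : Summable fun i => ‖f i‖ ^ 2) :
    Summable fun p : ι × ι => ‖⟪b p.2, f p.1⟫_ℂ‖ ^ 2 := by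
  rw [summable_prod_of_nonneg (fun _ => by positivity)]
  refine ⟨fun i => (hasSum_norm_inner_sq b (f i)).summable, ?_⟩
  simpa only [(hasSum_norm_inner_sq b _).tsum_eq] using hf

theorem hasSum_comm_of_summable {F : ι → ι → ℂ} {g h : ι → ℂ}
    (hF : Summable fun p : ι × ι => F p.1 p.2) (hg : ∀ i, HasSum (F i) (g i))
    (hh : ∀ j, HasSum (fun i => F i j) (h j)) : ∃ c, HasSum h c ∧ HasSum g c := by
  obtain ⟨c, hc⟩ := hF
  have hc' : HasSum (fun p : ι × ι => F p.2 p.1) c :=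
    (Equiv.prodComm ι ι).hasSum_iff (f := fun p : ι × ι => F p.1 p.2) |>.2 hc
  exact ⟨c, hc'.prod_fiberwise hh, hc.prod_fiberwise hg⟩

/-- Cyclicity of the trace: `Tr (T S S) = Tr (S T S)` for symmetric `S`, `T` with `S`
Hilbert–Schmidt. -/
theorem exists_hasSum_inner (b : HilbertBasis ι ℂ ℋ) {T S : ℋ →L[ℂ] ℋ}
    (hT : ∀ x y, ⟪T x, y⟫_ℂ = ⟪x, T y⟫_ℂ) (hS : ∀ x y, ⟪S x, y⟫_ℂ = ⟪x, S y⟫_ℂ)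
    (hs : Summable fun i => ‖S (b i)‖ ^ 2) :
    ∃ c, HasSum (fun i => ⟪b i, T (S (S (b i)))⟫_ℂ) c ∧
      HasSum (fun i => ⟪S (b i), T (S (b i))⟫_ℂ) c := by
  have hTs : Summable fun i => ‖T (S (b i))‖ ^ 2 := by
    refine Summable.of_nonneg_of_le (fun _ => by positivity) (fun i => ?_) (hs.mul_left (‖T‖ ^ 2))
    rw [← mul_pow]
    gcongr
    exact T.le_opNorm _
  have h1 := summable_norm_inner_sq b hs
  have h2 := summable_norm_inner_sq b hTs
  -- Absolute summability of the double series, from `|αβ| ≤ |α|² + |β|²`; it allows the order of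
  -- summation to be exchanged.
  have h3 : Summable fun p : ι × ι =>
      ⟪S (b p.1), b p.2⟫_ℂ * ⟪b p.2, T (S (b p.1))⟫_ℂ := by
    refine Summable.of_norm_bounded (h1.add h2) fun p => ?_
    rw [norm_mul, norm_inner_symm]
    nlinarith [sq_nonneg (‖⟪b p.2, S (b p.1)⟫_ℂ‖ - ‖⟪b p.2, T (S (b p.1))⟫_ℂ‖),
      sq_nonneg (‖⟪b p.2, S (b p.1)⟫_ℂ‖), sq_nonneg (‖⟪b p.2, T (S (b p.1))⟫_ℂ‖)]
  refine hasSum_comm_of_summable (F := fun i j => ⟪S (b i), b j⟫_ℂ * ⟪b j, T (S (b i))⟫_ℂ) h3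
    (fun i => b.hasSum_inner_mul_inner _ _) fun i => ?_
  -- The column sums are Parseval for `S T b_i` and `S b_i`, once `S` and `T` are moved across the
  -- inner products.
  have h := b.hasSum_inner_mul_inner (S (T (b i))) (S (b i))
  have e : ⟪S (T (b i)), S (b i)⟫_ℂ = ⟪b i, T (S (S (b i)))⟫_ℂ := by rw [hS, hT]
  rw [e] at h
  have e' : (fun j => ⟪S (T (b i)), b j⟫_ℂ * ⟪b j, S (b i)⟫_ℂ)
      = fun j => ⟪S (b j), b i⟫_ℂ * ⟪b i, T (S (b j))⟫_ℂ := by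
    funext j
    rw [hS (T (b i)), hT, ← hS, mul_comm]
  rwa [e'] at h

variable [CompleteSpace ℋ]

theorem isTraceClass_iff {A : ℋ →L[ℂ] ℋ} (hA : A.IsPositive) :
    IsTraceClass A ↔ Summable fun i => ⟪basis ℋ i, A (basis ℋ i)⟫_ℂ := by
  rw [IsTraceClass, CFC.abs_of_nonneg A ((ContinuousLinearMap.nonneg_iff_isPositive A).2 hA)]

/-- For positive `T` and `A` with `A` trace-class, `Tr (T A) = Tr (S T S)` with `S = √A`. -/
theorem exists_hasSum_inner_comp {A : ℋ →L[ℂ] ℋ} (hA : A ∈ positiveTraceClass ℋ) :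
    ∃ S : ℋ →L[ℂ] ℋ, ∀ T : ℋ →L[ℂ] ℋ, T.IsPositive → ∃ c,
      HasSum (fun i => ⟪basis ℋ i, T (A (basis ℋ i))⟫_ℂ) c ∧
      HasSum (fun i => ⟪S (basis ℋ i), T (S (basis ℋ i))⟫_ℂ) c := by
  have h0 : 0 ≤ A := (ContinuousLinearMap.nonneg_iff_isPositive A).2 hA.1
  have hS : (CFC.sqrt A).IsPositive :=
    (ContinuousLinearMap.nonneg_iff_isPositive _).1 (CFC.sqrt_nonneg A)
  have hSS : ∀ x, CFC.sqrt A (CFC.sqrt A x) = A x := fun x =>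
    congrArg (fun T : ℋ →L[ℂ] ℋ => T x) (CFC.sqrt_mul_sqrt_self A h0)
  refine ⟨CFC.sqrt A, fun T hT => ?_⟩
  have h := exists_hasSum_inner (basis ℋ) hT.inner_left_eq_inner_right hS.inner_left_eq_inner_right ?_
  · simpa only [hSS] using h
  · have := (((isTraceClass_iff hA.1).1 hA.2).mapL Complex.reCLM)
    convert this using 1
    funext i
    rw [← hSS, ← hS.inner_left_eq_inner_right, inner_self_eq_norm_sq_to_K,
      RCLike.ofReal_eq_complex_ofReal, ← Complex.ofReal_pow]
    rfl

theorem summable_inner_comp {A : ℋ →L[ℂ] ℋ} (hA : A ∈ positiveTraceClass ℋ) {T : ℋ →L[ℂ] ℋ}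
    (hT : T.IsPositive) : Summable fun i => ⟪basis ℋ i, T (A (basis ℋ i))⟫_ℂ := by
  obtain ⟨S, hS⟩ := exists_hasSum_inner_comp hA
  obtain ⟨c, hc, -⟩ := hS T hT
  exact hc.summable

/-- `T A` itself need not be positive, but the series for `S T S` has nonnegative terms. -/
theorem trace_comp_nonneg {A : ℋ →L[ℂ] ℋ} (hA : A ∈ positiveTraceClass ℋ) {T : ℋ →L[ℂ] ℋ}
    (hT : T.IsPositive) : 0 ≤ (trace ((T : ℋ →ₗ[ℂ] ℋ) ∘ₗ (A : ℋ →ₗ[ℂ] ℋ))).re := by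
  obtain ⟨S, hS⟩ := exists_hasSum_inner_comp hA
  obtain ⟨c, hc, hc'⟩ := hS T hT
  have : trace ((T : ℋ →ₗ[ℂ] ℋ) ∘ₗ (A : ℋ →ₗ[ℂ] ℋ)) = c := hc.tsum_eq
  rw [this]
  exact (hc'.mapL Complex.reCLM).nonneg fun i => hT.re_inner_nonneg_right _

theorem monotone_trace_comp {A : ℋ →L[ℂ] ℋ} (hA : A ∈ positiveTraceClass ℋ)
    {T : ℕ → ℋ →L[ℂ] ℋ} (hT : ∀ n, (T n).IsPositive)
    (hm : ∀ x, Monotone fun n => RCLike.re ⟪x, T n x⟫_ℂ) :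
    Monotone fun n => (trace ((T n : ℋ →ₗ[ℂ] ℋ) ∘ₗ (A : ℋ →ₗ[ℂ] ℋ))).re := by
  obtain ⟨S, hS⟩ := exists_hasSum_inner_comp hA
  intro m n hmn
  obtain ⟨c, hc, hc'⟩ := hS (T m) (hT m)
  obtain ⟨d, hd, hd'⟩ := hS (T n) (hT n)
  have h1 : trace ((T m : ℋ →ₗ[ℂ] ℋ) ∘ₗ (A : ℋ →ₗ[ℂ] ℋ)) = c := hc.tsum_eq
  have h2 : trace ((T n : ℋ →ₗ[ℂ] ℋ) ∘ₗ (A : ℋ →ₗ[ℂ] ℋ)) = d := hd.tsum_eq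
  simp only [h1, h2]
  exact hasSum_le (fun i => hm _ hmn) (hc'.mapL Complex.reCLM) (hd'.mapL Complex.reCLM)

end Trace

end QState

namespace QState

open Filter Topology

/-! ### Finite-rank perturbations built from vectors in the range of `A`. -/

section Perturbation

variable {ℋ : Type*} [NormedAddCommGroup ℋ] [InnerProductSpace ℂ ℋ] {κ : Type*} [Fintype κ]

/-- The operator `∑ x_j |w_j⟩⟨w_j|`. -/
noncomputable def rankOneSum (x : κ → ℝ) (w : κ → ℋ) : ℋ →L[ℂ] ℋ :=
  ∑ j, (x j : ℂ) • InnerProductSpace.rankOne ℂ (w j) (w j)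

theorem rankOneSum_apply (x : κ → ℝ) (w : κ → ℋ) (z : ℋ) :
    rankOneSum x w z = ∑ j, ((x j : ℂ) * ⟪w j, z⟫_ℂ) • w j := by
  simp [rankOneSum, mul_smul]

theorem rankOneSum_neg (x : κ → ℝ) (w : κ → ℋ) : rankOneSum (-x) w = -rankOneSum x w := by
  simp [rankOneSum]

theorem inner_rankOneSum (x : κ → ℝ) (w : κ → ℋ) (y z : ℋ) :
    ⟪y, rankOneSum x w z⟫_ℂ = ∑ j, (x j : ℂ) * (⟪w j, z⟫_ℂ * ⟪y, w j⟫_ℂ) := by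
  simp only [rankOneSum_apply, inner_sum, inner_smul_right, mul_assoc]

theorem hasSum_inner_rankOneSum {ι : Type*} (b : HilbertBasis ι ℂ ℋ) (T : ℋ →L[ℂ] ℋ)
    (x : κ → ℝ) (w : κ → ℋ) :
    HasSum (fun i => ⟪b i, T (rankOneSum x w (b i))⟫_ℂ) (∑ j, (x j : ℂ) * ⟪w j, T (w j)⟫_ℂ) := by
  have h : ∀ i, ⟪b i, T (rankOneSum x w (b i))⟫_ℂ
      = ∑ j, (x j : ℂ) * (⟪w j, b i⟫_ℂ * ⟪b i, T (w j)⟫_ℂ) := by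
    intro i
    simp only [rankOneSum_apply, map_sum, map_smul, inner_sum, inner_smul_right, mul_assoc]
  simp only [h]
  exact hasSum_sum fun j _ => (b.hasSum_inner_mul_inner _ _).mul_left _

variable [CompleteSpace ℋ]

/-- Cauchy–Schwarz for the form `⟨·, A ·⟩`, read off from `√A`. It says `|A a⟩⟨A a| ≤ ⟨a, A a⟩ A`,
which is why perturbing vectors are taken in the range of `A`. -/
theorem norm_inner_apply_sq_le {A : ℋ →L[ℂ] ℋ} (hA : A.IsPositive) (a z : ℋ) :
    ‖⟪A a, z⟫_ℂ‖ ^ 2 ≤ RCLike.re ⟪a, A a⟫_ℂ * RCLike.re ⟪z, A z⟫_ℂ := by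
  have h0 : 0 ≤ A := (ContinuousLinearMap.nonneg_iff_isPositive A).2 hA
  have hS : (CFC.sqrt A).IsPositive :=
    (ContinuousLinearMap.nonneg_iff_isPositive _).1 (CFC.sqrt_nonneg A)
  have hSS : ∀ x y, ⟪x, A y⟫_ℂ = ⟪CFC.sqrt A x, CFC.sqrt A y⟫_ℂ := fun x y => by
    rw [hS.inner_left_eq_inner_right]
    exact congrArg (fun T : ℋ →L[ℂ] ℋ => ⟪x, T y⟫_ℂ) (CFC.sqrt_mul_sqrt_self A h0).symm
  rw [hA.inner_left_eq_inner_right, hSS, hSS, hSS, inner_self_eq_norm_sq, inner_self_eq_norm_sq,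
    ← mul_pow]
  gcongr
  exact norm_inner_le_norm _ _

/-- Each rank-one term is dominated by a multiple of `A`; the assumption on `x` makes the total at
least `-A`. -/
theorem isPositive_add_rankOneSum {A : ℋ →L[ℂ] ℋ} (hA : A.IsPositive) (x : κ → ℝ) (a : κ → ℋ)
    (hx : ∑ j, |x j| * RCLike.re ⟪a j, A (a j)⟫_ℂ ≤ 1) :
    (A + rankOneSum x fun j => A (a j)).IsPositive := by
  rw [← ContinuousLinearMap.isPositive_toLinearMap_iff, LinearMap.isPositive_iff_complex]
  intro z
  have h1 : ⟪z, rankOneSum x (fun j => A (a j)) z⟫_ℂ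
      = ((∑ j, x j * ‖⟪A (a j), z⟫_ℂ‖ ^ 2 : ℝ) : ℂ) := by
    rw [inner_rankOneSum, Complex.ofReal_sum]
    refine Finset.sum_congr rfl fun j _ => ?_
    rw [Complex.ofReal_mul, ← inner_conj_symm z, Complex.mul_conj, Complex.normSq_eq_norm_sq]
  have h2 : ⟪z, A z⟫_ℂ = ((RCLike.re ⟪z, A z⟫_ℂ : ℝ) : ℂ) := by
    have := ((LinearMap.isPositive_iff_complex (A : ℋ →ₗ[ℂ] ℋ)).1 hA z).1
    have e : ⟪A z, z⟫_ℂ = ⟪z, A z⟫_ℂ := hA.inner_left_eq_inner_right z z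
    rw [← e]
    exact this.symm
  have h3 : ⟪z, (A + rankOneSum x fun j => A (a j)) z⟫_ℂ
      = ((RCLike.re ⟪z, A z⟫_ℂ + ∑ j, x j * ‖⟪A (a j), z⟫_ℂ‖ ^ 2 : ℝ) : ℂ) := by
    rw [add_apply, inner_add_right, h1, h2]
    simp
  have h4 : ⟪(A + rankOneSum x fun j => A (a j)) z, z⟫_ℂ
      = ((RCLike.re ⟪z, A z⟫_ℂ + ∑ j, x j * ‖⟪A (a j), z⟫_ℂ‖ ^ 2 : ℝ) : ℂ) := by
    rw [← inner_conj_symm, h3, Complex.conj_ofReal]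
  rw [ContinuousLinearMap.coe_coe, h4]
  refine ⟨congrArg Complex.ofReal (Complex.ofReal_re _), ?_⟩
  have h5 : -(∑ j, |x j| * RCLike.re ⟪a j, A (a j)⟫_ℂ) * RCLike.re ⟪z, A z⟫_ℂ
      ≤ ∑ j, x j * ‖⟪A (a j), z⟫_ℂ‖ ^ 2 := by
    rw [neg_mul, neg_le, ← Finset.sum_neg_distrib, Finset.sum_mul]
    refine Finset.sum_le_sum fun j _ => ?_
    calc -(x j * ‖⟪A (a j), z⟫_ℂ‖ ^ 2) = (-x j) * ‖⟪A (a j), z⟫_ℂ‖ ^ 2 := by ring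
      _ ≤ |x j| * ‖⟪A (a j), z⟫_ℂ‖ ^ 2 := by gcongr; exact neg_le_abs _
      _ ≤ |x j| * (RCLike.re ⟪a j, A (a j)⟫_ℂ * RCLike.re ⟪z, A z⟫_ℂ) := by
        gcongr
        exact norm_inner_apply_sq_le hA _ _
      _ = _ := by ring
  have h6 := hA.re_inner_nonneg_right z
  have h7 := mul_le_mul_of_nonneg_right hx h6
  change 0 ≤ RCLike.re ⟪z, A z⟫_ℂ + ∑ j, x j * ‖⟪A (a j), z⟫_ℂ‖ ^ 2
  linarith

theorem trace_comp_add_rankOneSum {A : ℋ →L[ℂ] ℋ} (hA : A ∈ positiveTraceClass ℋ)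
    {T : ℋ →L[ℂ] ℋ} (hT : T.IsPositive) (x : κ → ℝ) (w : κ → ℋ) :
    trace ((T : ℋ →ₗ[ℂ] ℋ) ∘ₗ ((A + rankOneSum x w : ℋ →L[ℂ] ℋ) : ℋ →ₗ[ℂ] ℋ))
      = trace ((T : ℋ →ₗ[ℂ] ℋ) ∘ₗ (A : ℋ →ₗ[ℂ] ℋ)) + ∑ j, (x j : ℂ) * ⟪w j, T (w j)⟫_ℂ := by
  have h := (summable_inner_comp hA hT).hasSum.add (hasSum_inner_rankOneSum (basis ℋ) T x w)
  refine Eq.trans ?_ h.tsum_eq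
  refine tsum_congr fun i => ?_
  simp

theorem trace_add_rankOneSum {A : ℋ →L[ℂ] ℋ} (hA : A ∈ positiveTraceClass ℋ)
    (x : κ → ℝ) (w : κ → ℋ) :
    trace ((A + rankOneSum x w : ℋ →L[ℂ] ℋ) : ℋ →ₗ[ℂ] ℋ)
      = trace (A : ℋ →ₗ[ℂ] ℋ) + ((∑ j, x j * ‖w j‖ ^ 2 : ℝ) : ℂ) := by
  have h := trace_comp_add_rankOneSum hA (ContinuousLinearMap.isPositive_one) x w
  have h1 : ((1 : ℋ →L[ℂ] ℋ) : ℋ →ₗ[ℂ] ℋ) = LinearMap.id := rfl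
  rw [h1, LinearMap.id_comp, LinearMap.id_comp] at h
  rw [h]
  congr 1
  push_cast
  refine Finset.sum_congr rfl fun j _ => ?_
  change (x j : ℂ) * ⟪w j, w j⟫_ℂ = _
  rw [inner_self_eq_norm_sq_to_K]
  rfl

theorem add_rankOneSum_mem {A : ℋ →L[ℂ] ℋ} (hA : A ∈ positiveTraceClass ℋ) (x : κ → ℝ)
    (a : κ → ℋ) (hx : ∑ j, |x j| * RCLike.re ⟪a j, A (a j)⟫_ℂ ≤ 1) :
    A + rankOneSum x (fun j => A (a j)) ∈ positiveTraceClass ℋ := by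
  have hp := isPositive_add_rankOneSum hA.1 x a hx
  refine ⟨hp, (isTraceClass_iff hp).2 ?_⟩
  have h := ((isTraceClass_iff hA.1).1 hA.2).add
    (hasSum_inner_rankOneSum (basis ℋ) 1 x fun j => A (a j)).summable
  refine h.congr fun i => ?_
  simp

/-- On the range of a positive trace-class operator `A`, the quadratic form of a positive `T` is
controlled by `Tr (T A)`. -/
theorem inner_le_trace_comp {A : ℋ →L[ℂ] ℋ} (hA : A ∈ positiveTraceClass ℋ)
    {T : ℋ →L[ℂ] ℋ} (hT : T.IsPositive) (a : ℋ) :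
    RCLike.re ⟪A a, T (A a)⟫_ℂ ≤ (1 + RCLike.re ⟪a, A a⟫_ℂ) *
      (trace ((T : ℋ →ₗ[ℂ] ℋ) ∘ₗ (A : ℋ →ₗ[ℂ] ℋ))).re := by
  have h0 := hA.1.re_inner_nonneg_right a
  set c := RCLike.re ⟪a, A a⟫_ℂ with hc
  have hc1 : 0 < 1 + c := by linarith
  -- Subtracting `(1 + c)⁻¹ |A a⟩⟨A a|` keeps `A` positive since `c / (1 + c) ≤ 1`; using `1 + c`
  -- also covers `c = 0`.
  have hmem := add_rankOneSum_mem hA (fun _ : Unit => -(1 + c)⁻¹) (fun _ => a) (by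
    simp only [Finset.univ_unique, Finset.sum_singleton, abs_neg, ← hc]
    rw [abs_of_pos (inv_pos.2 hc1), inv_mul_le_iff₀ hc1]
    linarith)
  have h := trace_comp_nonneg hmem hT
  rw [trace_comp_add_rankOneSum hA hT] at h
  simp only [Finset.univ_unique, Finset.sum_singleton, Complex.add_re, Complex.re_ofReal_mul] at h
  change 0 ≤ _ + -(1 + c)⁻¹ * RCLike.re ⟪A a, T (A a)⟫_ℂ at h
  have h2 : (1 + c)⁻¹ * RCLike.re ⟪A a, T (A a)⟫_ℂ
      ≤ (trace ((T : ℋ →ₗ[ℂ] ℋ) ∘ₗ (A : ℋ →ₗ[ℂ] ℋ))).re := by linarith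
  rwa [inv_mul_le_iff₀ hc1] at h2

/-- If `Tr H A` is finite, then `H` has a finite quadratic form `q` on the range of `A`, and the
perturbations `∑ x_j |A a_j⟩⟨A a_j|` with `∑ x_j q(a_j) = 0` do not change `Tr H A`. -/
theorem exists_expectedValue_add_rankOneSum {H : ℋ →ₗ.[ℂ] ℋ} (hd : Dense (H.domain : Set ℋ))
    {A : ℋ →L[ℂ] ℋ} (hA : A ∈ positiveTraceClass ℋ) {e : ℝ} (he : expectedValue H A ≤ e) :
    ∃ q : ℋ → ℝ, ∀ (x : κ → ℝ) (a : κ → ℋ), ∑ j, x j * q (a j) = 0 →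
      expectedValue H (A + rankOneSum x fun j => A (a j)) = expectedValue H A := by
  obtain ⟨T, hT, hpos, hm⟩ := exists_truncation_eq H hd
  have hmono := monotone_trace_comp hA hpos hm
  set φ : ℕ → ℝ := fun n => (trace ((T n : ℋ →ₗ[ℂ] ℋ) ∘ₗ (A : ℋ →ₗ[ℂ] ℋ))).re with hφ
  have hmono' : Monotone fun n => (φ n : EReal) := fun m n hmn =>
    EReal.coe_le_coe_iff.2 (hmono hmn)
  -- In `EReal` the monotone limit always exists. It yields the bound `φ n ≤ e`, after which the
  -- limit can be taken in `ℝ`.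
  have hval : expectedValue H A = ⨆ n, (φ n : EReal) := by
    simp only [expectedValue, hT]
    exact (tendsto_atTop_iSup hmono').limUnder_eq
  have hφe : ∀ n, φ n ≤ e := fun n => by
    rw [hval] at he
    exact EReal.coe_le_coe_iff.1 ((le_iSup (fun n => (φ n : EReal)) n).trans he)
  have hφlim : Tendsto φ atTop (𝓝 (⨆ n, φ n)) :=
    tendsto_atTop_ciSup hmono ⟨e, Set.forall_mem_range.2 hφe⟩
  have hval' : expectedValue H A = ((⨆ n, φ n : ℝ) : EReal) := by
    simp only [expectedValue, hT]
    exact ((continuous_coe_real_ereal.tendsto _).comp hφlim).limUnder_eq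
  have hq : ∀ a, Tendsto (fun n => RCLike.re ⟪A a, T n (A a)⟫_ℂ) atTop
      (𝓝 (⨆ n, RCLike.re ⟪A a, T n (A a)⟫_ℂ)) := by
    intro a
    refine tendsto_atTop_ciSup (hm _) ⟨(1 + RCLike.re ⟪a, A a⟫_ℂ) * e, Set.forall_mem_range.2
      fun n => (inner_le_trace_comp hA (hpos n) a).trans ?_⟩
    have := hA.1.re_inner_nonneg_right a
    exact mul_le_mul_of_nonneg_left (hφe n) (by linarith)
  refine ⟨fun a => ⨆ n, RCLike.re ⟪A a, T n (A a)⟫_ℂ, fun x a hx => ?_⟩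
  -- The added terms tend to `∑ x_j q(a_j) = 0`.
  have hlim : Tendsto (fun n => φ n + ∑ j, x j * RCLike.re ⟪A (a j), T n (A (a j))⟫_ℂ) atTop
      (𝓝 (⨆ n, φ n)) := by
    have := hφlim.add (tendsto_finsetSum Finset.univ fun j _ => (hq (a j)).const_mul (x j))
    rwa [hx, add_zero] at this
  rw [hval']
  simp only [expectedValue, hT]
  refine Tendsto.limUnder_eq (Tendsto.congr (fun n => ?_)
    ((continuous_coe_real_ereal.tendsto _).comp hlim))
  rw [trace_comp_add_rankOneSum hA (hpos n), Complex.add_re, Complex.re_sum]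
  simp only [Complex.re_ofReal_mul]
  rfl

end Perturbation

end QState

namespace QState

/-! ### Dimension count and extreme points. -/

section ExtremePoints

variable {ℋ : Type*} [NormedAddCommGroup ℋ] [InnerProductSpace ℂ ℋ]

theorem exists_linearIndependent_of_one_lt_rank {f : ℋ →ₗ[ℂ] ℋ} (hf : ¬ f.rank ≤ 1) :
    ∃ a b, LinearIndependent ℂ ![f a, f b] := by
  by_contra! h
  apply hf
  rw [LinearMap.rank, rank_submodule_le_one_iff']
  by_cases h0 : ∃ a, f a ≠ 0
  · obtain ⟨a, ha⟩ := h0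
    refine ⟨f a, ?_⟩
    rintro _ ⟨b, rfl⟩
    have := h a b
    rw [LinearIndependent.pair_iff' ha] at this
    push Not at this
    exact Submodule.mem_span_singleton.2 this
  · push Not at h0
    refine ⟨0, ?_⟩
    rintro _ ⟨b, rfl⟩
    rw [h0]
    exact Submodule.zero_mem _

/-- The rank-one operators of `u`, `v`, `u + v`, `u + i v` are linearly independent over `ℝ` when
`u`, `v` are linearly independent. -/
theorem eq_zero_of_rankOneSum_eq_zero {u v : ℋ} (huv : LinearIndependent ℂ ![u, v])
    {x : Fin 4 → ℝ} (hx : rankOneSum x ![u, v, u + v, u + Complex.I • v] = 0) : x = 0 := by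
  have key := LinearIndependent.pair_iff.1 huv
  -- Apply the operator to `z` and compare coefficients of `u` and `v`: each is the inner product of
  -- a fixed vector with `z`, so both vectors vanish. Independence of `u`, `v` is then used again on
  -- them.
  have h : ∀ z, ⟪(x 0 : ℂ) • u + (x 2 : ℂ) • (u + v) + (x 3 : ℂ) • (u + Complex.I • v), z⟫_ℂ = 0 ∧
      ⟪(x 1 : ℂ) • v + (x 2 : ℂ) • (u + v) - (Complex.I * x 3 : ℂ) • (u + Complex.I • v), z⟫_ℂ
        = 0 := by
    intro z
    have hz : rankOneSum x ![u, v, u + v, u + Complex.I • v] z = 0 := by rw [hx]; rfl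
    rw [rankOneSum_apply] at hz
    simp only [Fin.sum_univ_four, Matrix.cons_val] at hz
    apply key
    rw [← hz]
    simp only [inner_add_left, inner_sub_left, inner_smul_left, Complex.conj_ofReal, map_mul,
      Complex.conj_I]
    module
  have h1 := inner_self_eq_zero.1 (h _).1
  have h2 := inner_self_eq_zero.1 (h _).2
  obtain ⟨h3, h4⟩ := key (x 0 + x 2 + x 3 : ℂ) (x 2 + x 3 * Complex.I : ℂ) (by
    rw [← h1]; module)
  obtain ⟨-, h5⟩ := key (x 2 - Complex.I * x 3 : ℂ)
      (x 1 + x 2 - Complex.I * x 3 * Complex.I : ℂ) (by rw [← h2]; module)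
  have e1 := congrArg Complex.re h3
  have e2 := congrArg Complex.re h4
  have e3 := congrArg Complex.im h4
  have e4 := congrArg Complex.re h5
  simp at e1 e2 e3 e4
  funext j
  fin_cases j <;> simp <;> linarith

variable [CompleteSpace ℋ]

/-- Four real coefficients against three linear conditions leave a nonzero solution, and the
independence of the four rank-one operators makes `D` nonzero. -/
theorem exists_perturbation {H : Fin 2 → (ℋ →ₗ.[ℂ] ℋ)}
    (hd : ∀ k, Dense ((H k).domain : Set ℋ)) {A : ℋ →L[ℂ] ℋ} (hA : A ∈ positiveTraceClass ℋ)
    {e : Fin 2 → ℝ} (he : ∀ k, expectedValue (H k) A ≤ e k)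
    (hr : ¬ (A : ℋ →ₗ[ℂ] ℋ).rank ≤ 1) :
    ∃ D : ℋ →L[ℂ] ℋ, D ≠ 0 ∧ ∀ B, B = A + D ∨ B = A - D → B ∈ positiveTraceClass ℋ ∧
      trace (B : ℋ →ₗ[ℂ] ℋ) = trace (A : ℋ →ₗ[ℂ] ℋ) ∧
      ∀ k, expectedValue (H k) B = expectedValue (H k) A := by
  obtain ⟨a, b, hab⟩ := exists_linearIndependent_of_one_lt_rank hr
  choose q hq using fun k => exists_expectedValue_add_rankOneSum (κ := Fin 4) (hd k) hA (he k)
  let c : Fin 4 → ℋ := ![a, b, a + b, a + Complex.I • b]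
  have hc : (fun j => A (c j)) = ![A a, A b, A a + A b, A a + Complex.I • A b] := by
    funext j
    fin_cases j <;> simp [c]
  -- Rows: the trace and the two energies of the rank-one operators of `A (c j)`.
  let M : Matrix (Fin 3) (Fin 4) ℝ :=
    Matrix.of ![fun j => ‖A (c j)‖ ^ 2, fun j => q 0 (c j), fun j => q 1 (c j)]
  obtain ⟨x, hx, hx0⟩ := (Submodule.ne_bot_iff _).1
    (LinearMap.ker_ne_bot_of_finrank_lt (f := M.mulVecLin) (by simp))
  have hxM : ∀ i, ∑ j, x j * M i j = 0 := by
    intro i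
    have := congrFun (LinearMap.mem_ker.1 hx) i
    simpa [Matrix.mulVec, dotProduct, mul_comm] using this
  have hc0 : ∀ j, 0 ≤ RCLike.re ⟪c j, A (c j)⟫_ℂ := fun j => hA.1.re_inner_nonneg_right _
  set s := ∑ j, |x j| * RCLike.re ⟪c j, A (c j)⟫_ℂ with hs
  have hs0 : 0 ≤ s := Finset.sum_nonneg fun j _ => mul_nonneg (abs_nonneg _) (hc0 j)
  have hs1 : 0 < 1 + s := by linarith
  -- This size of `r` gives total weight `s / (1 + s) ≤ 1`, as positivity requires; both signs of
  -- `r` are needed.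
  have key : ∀ r : ℝ, |r| = (1 + s)⁻¹ →
      A + rankOneSum (r • x) (fun j => A (c j)) ∈ positiveTraceClass ℋ ∧
      trace ((A + rankOneSum (r • x) (fun j => A (c j)) : ℋ →L[ℂ] ℋ) : ℋ →ₗ[ℂ] ℋ)
        = trace (A : ℋ →ₗ[ℂ] ℋ) ∧
      ∀ k, expectedValue (H k) (A + rankOneSum (r • x) (fun j => A (c j)))
        = expectedValue (H k) A := by
    intro r hr
    have hrM : ∀ i, ∑ j, (r • x) j * M i j = 0 := by
      intro i
      simp only [Pi.smul_apply, smul_eq_mul, mul_assoc, ← Finset.mul_sum, hxM, mul_zero]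
    refine ⟨add_rankOneSum_mem hA _ _ ?_, ?_, fun k => hq k _ _ ?_⟩
    · simp only [Pi.smul_apply, smul_eq_mul, abs_mul, mul_assoc, ← Finset.mul_sum, ← hs, hr]
      rw [inv_mul_le_iff₀ hs1]
      linarith
    · rw [trace_add_rankOneSum hA]
      have : ∑ j, (r • x) j * ‖A (c j)‖ ^ 2 = 0 := hrM 0
      rw [this, Complex.ofReal_zero, add_zero]
    · fin_cases k
      · exact hrM 1
      · exact hrM 2
  refine ⟨rankOneSum ((1 + s)⁻¹ • x) fun j => A (c j), fun h => ?_, ?_⟩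
  · rw [hc] at h
    exact hx0 ((smul_eq_zero.1 (eq_zero_of_rankOneSum_eq_zero hab h)).resolve_left
      (inv_pos.2 hs1).ne')
  · rintro B (rfl | rfl)
    · exact key _ (abs_of_pos (inv_pos.2 hs1))
    · rw [sub_eq_add_neg, ← rankOneSum_neg, ← neg_smul]
      exact key _ (by rw [abs_neg, abs_of_pos (inv_pos.2 hs1)])

/-- If membership of a positive trace-class operator in `K` only depends on its trace, then the
extreme points of `K` under two energy constraints have rank at most one. -/
theorem rank_le_one_of_mem_extremePoints {H : Fin 2 → (ℋ →ₗ.[ℂ] ℋ)}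
    (hd : ∀ k, Dense ((H k).domain : Set ℋ)) {K : Set (ℋ →L[ℂ] ℋ)} {p : ℂ → Prop}
    (hK : K = {A | A ∈ positiveTraceClass ℋ ∧ p (trace (A : ℋ →ₗ[ℂ] ℋ))})
    {E : Fin 2 → ℝ} {s : Set (Fin 2)} {A : ℋ →L[ℂ] ℋ}
    (hA : A ∈ Set.extremePoints ℝ (constrained K H E s)) : (A : ℋ →ₗ[ℂ] ℋ).rank ≤ 1 := by
  subst hK
  rw [mem_extremePoints_iff_left] at hA
  obtain ⟨⟨⟨hAp, hAt⟩, hle, heq⟩, hext⟩ := hA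
  by_contra hr
  have he : ∀ k, expectedValue (H k) A ≤ E k := fun k => by
    by_cases hk : k ∈ s
    · exact (heq k hk).le
    · exact hle k hk
  obtain ⟨D, hD, hB⟩ := exists_perturbation hd hAp he hr
  have hmem : ∀ B, B = A + D ∨ B = A - D → B ∈ constrained
      {A | A ∈ positiveTraceClass ℋ ∧ p (trace (A : ℋ →ₗ[ℂ] ℋ))} H E s := by
    intro B h
    obtain ⟨h1, h2, h3⟩ := hB B h
    refine ⟨⟨h1, by rwa [h2]⟩, fun k hk => ?_, fun k hk => ?_⟩
    · rw [h3]; exact hle k hk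
    · rw [h3]; exact heq k hk
  have := hext _ (hmem _ (Or.inl rfl)) _ (hmem _ (Or.inr rfl))
    ⟨1 / 2, 1 / 2, by norm_num, by norm_num, by norm_num, by module⟩
  exact hD (by simpa using this)

/-- A positive operator of rank at most one and trace one is a pure state. -/
theorem isPureState_of_rank_le_one {A : ℋ →L[ℂ] ℋ} (hA : A.IsPositive)
    (ht : trace (A : ℋ →ₗ[ℂ] ℋ) = 1) (hr : (A : ℋ →ₗ[ℂ] ℋ).rank ≤ 1) : IsPureState A := by
  have hA0 : A ≠ 0 := by
    rintro rfl
    simp [trace] at ht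
  obtain ⟨v₀, hv₀⟩ := (rank_submodule_le_one_iff' _).1 hr
  have hspan : ∀ x, ∃ c : ℂ, c • v₀ = A x := fun x =>
    Submodule.mem_span_singleton.1 (hv₀ ⟨x, rfl⟩)
  have hv0 : v₀ ≠ 0 := by
    rintro rfl
    apply hA0
    ext x
    obtain ⟨c, hc⟩ := hspan x
    simpa using hc.symm
  have hn : (⟪v₀, v₀⟫_ℂ) ≠ 0 := inner_self_ne_zero.2 hv0
  obtain ⟨l, hl⟩ := hspan v₀
  -- `v₀` is an eigenvector with eigenvalue `l`, real by symmetry, so `A` is `l` times the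
  -- projection onto `v₀`; the trace then gives `l = 1`.
  have happ : ∀ x, A x = (l * (⟪v₀, x⟫_ℂ / ⟪v₀, v₀⟫_ℂ)) • v₀ := by
    intro x
    obtain ⟨c, hc⟩ := hspan x
    have h1 := hA.inner_left_eq_inner_right v₀ x
    have h2 := hA.inner_left_eq_inner_right v₀ v₀
    rw [← hl, ← hc, inner_smul_left, inner_smul_right] at h1
    rw [← hl, inner_smul_left, inner_smul_right] at h2
    have h3 := mul_right_cancel₀ hn h2
    rw [h3] at h1
    rw [← hc, ← mul_div_assoc, h1, mul_div_cancel_right₀ _ hn]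
  have htr : trace (A : ℋ →ₗ[ℂ] ℋ) = l := by
    have h := ((basis ℋ).hasSum_inner_mul_inner v₀ v₀).mul_left (l / ⟪v₀, v₀⟫_ℂ)
    rw [div_mul_cancel₀ _ hn] at h
    refine Eq.trans (tsum_congr fun i => ?_) h.tsum_eq
    rw [ContinuousLinearMap.coe_coe, happ, inner_smul_right]
    ring
  rw [ht] at htr
  subst htr
  refine ⟨⟨?_, hA.isSelfAdjoint⟩, hr.antisymm ?_⟩
  · ext x
    rw [mul_apply_eq_comp, happ x, map_smul, ← hl, one_smul]
  · rw [Cardinal.one_le_iff_ne_zero, LinearMap.rank, Ne, Submodule.rank_eq_zero,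
      LinearMap.range_eq_bot]
    intro h
    exact hA0 (ContinuousLinearMap.coe_injective h)

end ExtremePoints

end QState

theorem theorem4p2 {ℋ : Type*} [NormedAddCommGroup ℋ] [InnerProductSpace ℂ ℋ]
    [CompleteSpace ℋ] [TopologicalSpace.SeparableSpace ℋ]
    (H : Fin 2 → (ℋ →ₗ.[ℂ] ℋ)) (hH : ∀ k, QState.IsPositiveOperator (H k))
    (E : Fin 2 → ℝ) (s : Set (Fin 2)) :
    (∀ ρ ∈ Set.extremePoints ℝ (QState.constrained (QState.states ℋ) H E s),
      QState.IsPureState ρ) ∧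
    (∀ ρ ∈ Set.extremePoints ℝ (QState.constrained (QState.subnormalizedStates ℋ) H E s),
      (ρ : ℋ →ₗ[ℂ] ℋ).rank ≤ 1) := by
  have hd : ∀ k, Dense ((H k).domain : Set ℋ) := fun k => (hH k).1.dense_domain
  refine ⟨fun ρ hρ => ?_, fun ρ hρ => ?_⟩
  · exact QState.isPureState_of_rank_le_one hρ.1.1.1.1 hρ.1.1.2
      (QState.rank_le_one_of_mem_extremePoints hd (p := fun z => z = 1) rfl hρ)
  · exact QState.rank_le_one_of_mem_extremePoints hd (p := fun z => z.re ≤ 1) rfl hρ
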